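/- Theorem 5 (Sample complexity for witnessing non-Gaussianity). Let $\mathcal H=L^2(\mathbb R)$ be the Hilbert space of a single bosonic mode, with Fock basis $(|n\rangle)_{n\ge 0}$ (the Hermite functions), number operator $\hat n$, and quadrature operators $\hat q_\theta=(\cos\theta)\hat x+(\sin\theta)\hat p=e^{i\theta\hat n}\hat x e^{-i\theta\hat n}$. For $x\in\mathbb R$, $\eta>0$ and an angle $\theta$, let $$\hat W_{\theta,x,\eta}=\int_{x-\eta/2}^{x+\eta/2}|q\rangle\langle q|_{\hat q_\theta}\,\mathrm dq$$ be the spectral projector of $\hat q_\theta$ onto the window $[x-\frac\eta2,x+\frac\eta2]$. The stellar rank of a unit vector $\psi$ is the number of zeros, counted with multiplicity, of its stellar function $\alpha\mapsto e^{|\alpha|^2/2}\langle\alpha^*|\psi\rangle$, where $|\alpha\rangle$ is the coherent state of amplitude $\alpha$; the stellar rank of a mixed state $\hat\rho$ is the infimum, over all statistical decompositions $\hat\rho=\sum_i p_i|\psi_i\rangle\langle\psi_i|$, of $\sup_i$ of the stellar ranks of the $\psi_i$. For $E\ge 0$, let $\mathcal S^E$ be the closed convex hull, in trace norm, of the pure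 states $|\psi\rangle\langle\psi|$ with $\langle\hat n\rangle_\psi\le E$, let $\mathcal S^E_0$ be the set of states in $\mathcal S^E$ of stellar rank $0$ (the Gaussian states with energy bounded by $E$), and let $$w^E_{\theta,x,\eta}=\inf_{\hat\sigma\in\mathcal S^E_0}\mathrm{Tr}(\hat\sigma\hat W_{\theta,x,\eta}).$$ Suppose that the state being measured is some $\hat\sigma\in\mathcal S^E_0$, let $q_1,\dots,q_M$ ($M\ge 1$) be independent outcomes of the measurement of $\hat q_\theta$ on $\hat\sigma$, that is, i.i.d. real random variables with $\Pr(q_j\in A)=\mathrm{Tr}(\hat\sigma\,1_A(\hat q_\theta))$ for every Borel set $A$, and let $\bar w_{\hat\sigma}=\frac1M\sum_{j=1}^M\chi_{[x-\eta/2,\,x+\eta/2]}(q_j)$. Then, for every $\epsilon>0$, $$\Pr\left(\bar w_{\hat\sigma}<w^E_{\theta,x,\eta}-\epsilon\right)\le\exp(-2M\epsilon^2).$$ -/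

import Mathlib

noncomputable section

namespace Bosonic

open MeasureTheory Polynomial
open scoped ENNReal InnerProductSpace

/-! ### The Fock basis of a single bosonic mode -/

/-- The Hilbert space `L²(ℝ)` of a single bosonic mode. -/
abbrev Mode : Type := Lp ℂ 2 (volume : Measure ℝ)

theorem integrable_eval_mul_exp (p : ℝ[X]) {b : ℝ} (hb : 0 < b) :
    Integrable fun x : ℝ => p.eval x * Real.exp (-b * x ^ 2) := by
  induction p using Polynomial.induction_on' with
  | add p q hp hq =>
    simp only [eval_add, add_mul]
    exact hp.add hq
  | monomial n a =>
    have h := integrable_rpow_mul_exp_neg_mul_sq hb (s := n) (by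
      have : (0 : ℝ) ≤ n := n.cast_nonneg
      linarith)
    simpa [mul_assoc] using h.const_mul a

/-- The `n`-th Hermite function `(n! √π)^(-1/2) Heₙ(√2 x) exp(-x²/2)`, where `Heₙ` is the
probabilists' Hermite polynomial. -/
def hermiteFunction (n : ℕ) (x : ℝ) : ℝ :=
  (Real.sqrt (n.factorial * Real.sqrt Real.pi))⁻¹ *
    (aeval (Real.sqrt 2 * x) (hermite n) * Real.exp (-(x ^ 2 / 2)))

/-- The polynomial factors of the Hermite functions. -/
def hermiteFactor (n : ℕ) : ℝ[X] :=
  C (Real.sqrt (n.factorial * Real.sqrt Real.pi))⁻¹ *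
    ((hermite n).map (Int.castRingHom ℝ)).comp (C (Real.sqrt 2) * X)

theorem hermiteFunction_eq (n : ℕ) (x : ℝ) : hermiteFunction n x =
    (hermiteFactor n).eval x * Real.exp (-(1 / 2) * x ^ 2) := by
  have : -(x ^ 2 / 2) = -(1 / 2) * x ^ 2 := by ring
  simp [hermiteFunction, hermiteFactor, this, eval_comp, eval_map, aeval_def, mul_assoc]

theorem memLp_eval_mul_exp (p : ℝ[X]) {b : ℝ} (hb : 0 < b) :
    MemLp (fun x : ℝ => ((p.eval x * Real.exp (-b * x ^ 2) : ℝ) : ℂ)) 2 volume := by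
  have hc : Continuous fun x : ℝ => ((p.eval x * Real.exp (-b * x ^ 2) : ℝ) : ℂ) := by fun_prop
  rw [memLp_two_iff_integrable_sq_norm hc.aestronglyMeasurable]
  refine (integrable_eval_mul_exp (p ^ 2) (b := 2 * b) (by positivity)).congr (.of_forall fun x => ?_)
  have : Real.exp (-(2 * b) * x ^ 2) = Real.exp (-b * x ^ 2) ^ 2 := by
    rw [← Real.exp_nat_mul]; congr 1; push_cast; ring
  simp only [Complex.norm_real, eval_pow, this, Real.norm_eq_abs, sq_abs, mul_pow]

theorem memLp_hermiteFunction (n : ℕ) :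
    MemLp (fun x : ℝ => (hermiteFunction n x : ℂ)) 2 volume := by
  simp_rw [hermiteFunction_eq]
  exact memLp_eval_mul_exp _ (by norm_num)

/-- The Fock state `|n⟩`, i.e. the `n`-th Hermite function as an element of `L²(ℝ)`. It is the
normalised eigenvector of `n̂ = a† a` for the eigenvalue `n`, where `√2 a = x̂ + i p̂`. -/
def fock (n : ℕ) : Mode := (memLp_hermiteFunction n).toLp _

theorem fock_coeFn (n : ℕ) : fock n =ᵐ[volume] fun x : ℝ => (hermiteFunction n x : ℂ) :=
  (memLp_hermiteFunction n).coeFn_toLp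

theorem integrable_eval_mul_exp' (p : ℝ[X]) :
    Integrable fun x : ℝ => p.eval x * Real.exp (-(x ^ 2 / 2)) := by
  have := integrable_eval_mul_exp p (b := 1 / 2) (by norm_num)
  refine this.congr (.of_forall fun x => ?_)
  simp only
  congr 2; ring

theorem integral_hermite_succ (p : ℝ[X]) (n : ℕ) :
    ∫ x : ℝ, (p * (hermite (n + 1)).map (Int.castRingHom ℝ)).eval x * Real.exp (-(x ^ 2 / 2)) =
    ∫ x : ℝ, (derivative p * (hermite n).map (Int.castRingHom ℝ)).eval x *
      Real.exp (-(x ^ 2 / 2)) := by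
  set h := (hermite n).map (Int.castRingHom ℝ) with hh
  have hs : (hermite (n + 1)).map (Int.castRingHom ℝ) = X * h - derivative h := by
    rw [hermite_succ, Polynomial.map_sub, Polynomial.map_mul, map_X, derivative_map]
  have hz : ∫ x : ℝ, (derivative (p * h) - X * (p * h)).eval x * Real.exp (-(x ^ 2 / 2)) = 0 := by
    refine integral_eq_zero_of_hasDerivAt_of_integrable
      (f := fun x : ℝ => (p * h).eval x * Real.exp (-(x ^ 2 / 2))) (fun x => ?_)
      (integrable_eval_mul_exp' _) (integrable_eval_mul_exp' _)
    have h1 := (p * h).hasDerivAt x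
    have h2 : HasDerivAt (fun x : ℝ => -(x ^ 2 / 2)) (-x) x := by
      convert! ((hasDerivAt_pow 2 x).div_const 2).neg using 1
      simp
    convert! h1.mul h2.exp using 1
    simp only [eval_sub, eval_mul, eval_X]; ring
  rw [← sub_eq_zero, ← integral_sub (integrable_eval_mul_exp' _) (integrable_eval_mul_exp' _),
    ← neg_eq_zero, ← integral_neg, ← hz]
  congr 1; ext x
  rw [hs, derivative_mul]
  simp only [eval_sub, eval_mul, eval_add, eval_X]; ring

theorem integral_hermite (p : ℝ[X]) (n : ℕ) :
    ∫ x : ℝ, (p * (hermite n).map (Int.castRingHom ℝ)).eval x * Real.exp (-(x ^ 2 / 2)) =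
    ∫ x : ℝ, (derivative^[n] p).eval x * Real.exp (-(x ^ 2 / 2)) := by
  induction n generalizing p with
  | zero => simp
  | succ n ih => rw [integral_hermite_succ, ih, Function.iterate_succ_apply]

theorem integral_hermite_mul_hermite {m n : ℕ} (hmn : m ≤ n) :
    ∫ x : ℝ, aeval x (hermite m) * aeval x (hermite n) * Real.exp (-(x ^ 2 / 2)) =
      if m = n then n.factorial * Real.sqrt (2 * Real.pi) else 0 := by
  have h := integral_hermite ((hermite m).map (Int.castRingHom ℝ)) n
  simp only [eval_mul, eval_map] at h
  simp only [aeval_def, algebraMap_int_eq]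
  rw [h]
  have hd : ((hermite m).map (Int.castRingHom ℝ)).natDegree = m := by
    rw [(hermite_monic m).natDegree_map, natDegree_hermite]
  split_ifs with e
  · subst e
    have h1 : derivative^[m] ((hermite m).map (Int.castRingHom ℝ)) = C (m.factorial : ℝ) := by
      rw [eq_C_of_natDegree_le_zero ((natDegree_iterate_derivative _ m).trans (by rw [hd]; simp)),
        coeff_iterate_derivative]
      simp [Nat.descFactorial_self]
    rw [h1]
    simp only [eval_C]
    rw [integral_const_mul]
    have := integral_gaussian (1 / 2)
    have e : ∀ x : ℝ, -(1 / 2) * x ^ 2 = -(x ^ 2 / 2) := fun x => by ring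
    simp only [e] at this
    rw [this]
    congr 2; field_simp
  · rw [iterate_derivative_eq_zero (by rw [hd]; omega)]
    simp

theorem inner_fock_of_le {m n : ℕ} (hmn : m ≤ n) :
    ⟪fock m, fock n⟫_ℂ = if m = n then 1 else 0 := by
  rw [L2.inner_def]
  have h1 : ∫ x, ⟪fock m x, fock n x⟫_ℂ =
      ∫ x : ℝ, ((hermiteFunction m x * hermiteFunction n x : ℝ) : ℂ) := by
    refine integral_congr_ae ?_
    filter_upwards [fock_coeFn m, fock_coeFn n] with x hm hn
    rw [hm, hn]
    simp [mul_comm]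
  rw [h1, integral_complex_ofReal]
  have h2 : ∀ x, hermiteFunction m x * hermiteFunction n x =
      ((Real.sqrt (m.factorial * Real.sqrt Real.pi))⁻¹ *
        (Real.sqrt (n.factorial * Real.sqrt Real.pi))⁻¹) *
      (fun y : ℝ => aeval y (hermite m) * aeval y (hermite n) * Real.exp (-(y ^ 2 / 2)))
        (Real.sqrt 2 * x) := by
    intro x
    have : Real.exp (-((Real.sqrt 2 * x) ^ 2 / 2)) =
        Real.exp (-(x ^ 2 / 2)) * Real.exp (-(x ^ 2 / 2)) := by
      rw [← Real.exp_add, mul_pow, Real.sq_sqrt (by norm_num)]; congr 1; ring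
    simp only [hermiteFunction, this]; ring
  rw [funext h2, integral_const_mul,
    Measure.integral_comp_mul_left
      (fun y : ℝ => aeval y (hermite m) * aeval y (hermite n) * Real.exp (-(y ^ 2 / 2))),
    integral_hermite_mul_hermite hmn]
  split_ifs with e
  · subst e
    have hp : (0 : ℝ) < m.factorial * Real.sqrt Real.pi := by positivity
    rw [← mul_inv, Real.mul_self_sqrt hp.le, abs_of_pos (by positivity),
      Real.sqrt_mul (by norm_num), smul_eq_mul]
    have : (Real.sqrt 2) ≠ 0 := by positivity
    norm_cast
    field_simp
  · simp

theorem orthonormal_fock : Orthonormal ℂ fock := by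
  rw [orthonormal_iff_ite]
  intro m n
  rcases le_total m n with h | h
  · exact inner_fock_of_le h
  · rw [← inner_conj_symm, inner_fock_of_le h]
    by_cases e : m = n
    · simp [e]
    · simp [e, Ne.symm e]


theorem degree_hermiteFactor (n : ℕ) : (hermiteFactor n).degree = n := by
  have hl : (C (Real.sqrt 2) * X : ℝ[X]).degree = 1 := degree_C_mul_X (by positivity)
  have hnd : (C (Real.sqrt 2) * X : ℝ[X]).natDegree = 1 := natDegree_C_mul_X _ (by positivity)
  have h0 : ((hermite n).map (Int.castRingHom ℝ)).comp (C (Real.sqrt 2) * X) ≠ 0 := by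
    intro h
    rw [comp_eq_zero_iff] at h
    rcases h with h | ⟨-, h⟩
    · exact ((hermite_monic n).map (Int.castRingHom ℝ)).ne_zero h
    · rw [h] at hnd
      simp at hnd
  rw [hermiteFactor, degree_C_mul (by positivity), degree_eq_natDegree h0, natDegree_comp, hnd,
    (hermite_monic n).natDegree_map, natDegree_hermite, mul_one]

theorem integrable_exp_mul (f : Mode) (c : ℝ) :
    Integrable fun x : ℝ => Real.exp |c * x| * (Real.exp (-(x ^ 2 / 2)) * ‖f x‖) := by
  have hu : MemLp (fun x : ℝ => Real.exp |c * x| * Real.exp (-(x ^ 2 / 2))) 2 volume := by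
    have hc : Continuous fun x : ℝ => Real.exp |c * x| * Real.exp (-(x ^ 2 / 2)) := by fun_prop
    rw [memLp_two_iff_integrable_sq hc.aestronglyMeasurable]
    refine ((integrable_exp_neg_mul_sq (b := 1 / 2) (by norm_num)).const_mul
      (Real.exp (2 * c ^ 2))).mono' (by fun_prop) (.of_forall fun x => ?_)
    rw [Real.norm_eq_abs, abs_of_nonneg (by positivity), ← Real.exp_add, ← Real.exp_add,
      ← Real.exp_nat_mul, Real.exp_le_exp, abs_mul]
    have := sq_nonneg (2 * |c| - |x|)
    have h1 := sq_abs c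
    have h2 := sq_abs x
    push_cast
    nlinarith
  have := hu.integrable_mul (Lp.memLp f).norm
  refine this.congr (.of_forall fun x => ?_)
  simp [mul_assoc]

theorem integrable_eval_mul (f : Mode) (p : ℝ[X]) :
    Integrable fun x : ℝ => ((p.eval x * Real.exp (-(1 / 2) * x ^ 2) : ℝ) : ℂ) * f x :=
  (memLp_eval_mul_exp p (by norm_num)).integrable_mul (Lp.memLp f)

theorem integral_eval_mul_eq_zero (f : Mode) (hf : ∀ n, ⟪fock n, f⟫_ℂ = 0) (p : ℝ[X]) :
    ∫ x : ℝ, ((p.eval x * Real.exp (-(1 / 2) * x ^ 2) : ℝ) : ℂ) * f x = 0 := by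
  let S : Polynomial.Sequence ℝ := ⟨hermiteFactor, degree_hermiteFactor⟩
  have hp : p ∈ Submodule.span ℝ (Set.range S) := by
    rw [S.span fun i => isUnit_iff_ne_zero.2 (leadingCoeff_ne_zero.2 (S.ne_zero i))]
    trivial
  induction hp using Submodule.span_induction with
  | mem p hp =>
    obtain ⟨n, rfl⟩ := hp
    rw [← hf n, L2.inner_def]
    refine integral_congr_ae ?_
    filter_upwards [fock_coeFn n] with x hx
    rw [hx, hermiteFunction_eq]
    rw [RCLike.inner_apply, Complex.conj_ofReal, mul_comm]
  | zero => simp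
  | add p q _ _ hp hq =>
    rw [← add_zero (0 : ℂ)]
    nth_rw 1 [← hp]
    rw [← hq, ← integral_add (integrable_eval_mul f p) (integrable_eval_mul f q)]
    congr 1; ext x
    simp only [eval_add]; push_cast; ring
  | smul a p _ hp =>
    rw [← mul_zero (a : ℂ), ← hp, ← integral_const_mul]
    congr 1; ext x
    simp only [eval_smul, smul_eq_mul]; push_cast; ring

theorem fourier_gaussian_mul_eq_zero (f : Mode) (hf : ∀ n, ⟪fock n, f⟫_ℂ = 0) (w : ℝ) :
    ∫ x : ℝ, Complex.exp (((-2 * Real.pi * x * w : ℝ) : ℂ) * Complex.I) *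
      (((Real.exp (-(x ^ 2 / 2)) : ℝ) : ℂ) * f x) = 0 := by
  set c : ℝ := -2 * Real.pi * w with hc
  have key := hasSum_integral_of_dominated_convergence (μ := (volume : Measure ℝ))
    (F := fun (n : ℕ) (x : ℝ) => ((((c * x : ℝ) : ℂ) * Complex.I) ^ n / (n.factorial : ℂ)) *
      (((Real.exp (-(x ^ 2 / 2)) : ℝ) : ℂ) * f x))
    (f := fun x : ℝ => Complex.exp (((-2 * Real.pi * x * w : ℝ) : ℂ) * Complex.I) *
      (((Real.exp (-(x ^ 2 / 2)) : ℝ) : ℂ) * f x))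
    (fun n x => |c * x| ^ n / n.factorial * (Real.exp (-(x ^ 2 / 2)) * ‖f x‖))
    (fun n => by
      refine AEStronglyMeasurable.mul (Continuous.aestronglyMeasurable (by fun_prop))
        (AEStronglyMeasurable.mul (Continuous.aestronglyMeasurable (by fun_prop))
          (Lp.aestronglyMeasurable f)))
    (fun n => .of_forall fun x => le_of_eq (by
      simp only [norm_mul, norm_div, norm_pow, Complex.norm_real, Complex.norm_I, mul_one,
        Complex.norm_natCast, Real.norm_eq_abs, Real.abs_exp, abs_mul]))
    (.of_forall fun x => (Real.summable_pow_div_factorial _).mul_right _)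
    (by
      refine (integrable_exp_mul f c).congr (.of_forall fun x => ?_)
      simp only
      rw [tsum_mul_right, Real.exp_eq_exp_ℝ, NormedSpace.exp_eq_tsum_div])
    (.of_forall fun x => by
      refine HasSum.mul_right _ ?_
      have e : ((-2 * Real.pi * x * w : ℝ) : ℂ) = ((c * x : ℝ) : ℂ) := by
        rw [hc]; push_cast; ring
      rw [e, Complex.exp_eq_exp_ℂ]
      exact NormedSpace.expSeries_div_hasSum_exp _)
  have hz : ∀ n : ℕ, ∫ x : ℝ, ((((c * x : ℝ) : ℂ) * Complex.I) ^ n / (n.factorial : ℂ)) *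
      (((Real.exp (-(x ^ 2 / 2)) : ℝ) : ℂ) * f x) = 0 := by
    intro n
    rw [← mul_zero (((c : ℂ) * Complex.I) ^ n / (n.factorial : ℂ)),
      ← integral_eval_mul_eq_zero f hf (X ^ n), ← integral_const_mul]
    congr 1; ext x
    have e : -(1 / 2) * x ^ 2 = -(x ^ 2 / 2) := by ring
    rw [e]
    simp only [eval_pow, eval_X]
    push_cast; ring
  simp only [hz] at key
  exact key.unique hasSum_zero

theorem eq_zero_of_inner_fock (f : Mode) (hf : ∀ n, ⟪fock n, f⟫_ℂ = 0) : f = 0 := by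
  set g : ℝ → ℂ := fun x => ((Real.exp (-(x ^ 2 / 2)) : ℝ) : ℂ) * f x with hg
  have hgi : Integrable g := by
    have := integrable_eval_mul f 1
    refine this.congr (.of_forall fun x => ?_)
    have e : -(1 / 2) * x ^ 2 = -(x ^ 2 / 2) := by ring
    simp only [eval_one, one_mul, e, hg]
  have hF : ∀ w, VectorFourier.fourierIntegral Real.fourierChar volume (innerₗ ℝ).flip g w = 0 := by
    intro w
    rw [← fourier_gaussian_mul_eq_zero f hf w, VectorFourier.fourierIntegral]
    congr 1; ext x
    rw [Circle.smul_def, Real.fourierChar_apply, smul_eq_mul]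
    simp only [hg, LinearMap.flip_apply, innerₗ_apply_apply]
    congr 3
    simp; ring
  have h0 : ∀ᵐ x, g x = 0 := by
    refine ae_eq_zero_of_integral_contDiff_smul_eq_zero hgi.locallyIntegrable fun u hu hus => ?_
    let U : SchwartzMap ℝ ℂ := (hus.comp_left (g := Complex.ofReal) (by simp)).toSchwartzMap
      (Complex.ofRealCLM.contDiff.comp hu)
    obtain ⟨V, hV⟩ : ∃ V : SchwartzMap ℝ ℂ, FourierTransform.fourier V = U :=
      ⟨FourierTransformInv.fourierInv U, FourierTransform.fourier_fourierInv_eq U⟩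
    have h := VectorFourier.integral_fourierIntegral_smul_eq_flip (L := innerₗ ℝ)
      Real.continuous_fourierChar continuous_inner (V.integrable (μ := volume)) hgi
    simp only [hF, smul_zero, integral_zero] at h
    rw [← h]
    congr 1; ext x
    have : VectorFourier.fourierIntegral Real.fourierChar volume (innerₗ ℝ) V x = U x := by
      rw [← hV]; rfl
    rw [this]
    change u x • g x = ((u x : ℝ) : ℂ) • g x
    rw [Complex.coe_smul]
  rw [Lp.eq_zero_iff_ae_eq_zero]
  filter_upwards [h0] with x hx
  simpa [hg] using hx

/-- The Fock basis is a Hilbert basis of `L²(ℝ)`. -/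
def fockBasis : HilbertBasis ℕ ℂ Mode :=
  HilbertBasis.mkOfOrthogonalEqBot orthonormal_fock (by
    rw [Submodule.eq_bot_iff]
    intro f hf
    refine eq_zero_of_inner_fock f fun n => ?_
    exact (Submodule.mem_orthogonal _ _).1 hf _ (Submodule.subset_span ⟨n, rfl⟩))

theorem inner_phase_smul (θ : ℝ) (m n : ℕ) (f g : Mode) :
    ⟪Complex.exp (Complex.I * θ * m) • f, Complex.exp (Complex.I * θ * n) • g⟫_ℂ =
      Complex.exp (Complex.I * θ * (n - m)) * ⟪f, g⟫_ℂ := by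
  rw [inner_smul_left, inner_smul_right, ← mul_assoc, ← Complex.exp_conj, ← Complex.exp_add]
  congr 2
  simp; ring

/-- The Hilbert basis `e^{i θ n} |n⟩`. -/
def rotatedFockBasis (θ : ℝ) : HilbertBasis ℕ ℂ Mode :=
  HilbertBasis.mkOfOrthogonalEqBot (v := fun n : ℕ => Complex.exp (Complex.I * θ * n) • fock n)
    (by
      rw [orthonormal_iff_ite]
      intro m n
      rw [inner_phase_smul, orthonormal_iff_ite.1 orthonormal_fock]
      split_ifs with h
      · simp [h]
      · simp)
    (by
      rw [Submodule.eq_bot_iff]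
      intro f hf
      refine eq_zero_of_inner_fock f fun n => ?_
      have h := (Submodule.mem_orthogonal _ _).1 hf _ (Submodule.subset_span ⟨n, rfl⟩)
      rw [inner_smul_left] at h
      exact (mul_eq_zero.1 h).resolve_left (by simp [Complex.exp_ne_zero]))

/-! ### Quadrature measurements -/

/-- The phase rotation `e^{i θ n̂}`, i.e. the unitary operator with `|n⟩ ↦ e^{i θ n} |n⟩`. -/
def phaseRotation (θ : ℝ) : Mode ≃ₗᵢ[ℂ] Mode :=
  fockBasis.repr.trans (rotatedFockBasis θ).repr.symm

theorem norm_toLp_indicator_le (A : Set ℝ) (hA : MeasurableSet A) (f : Mode) :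
    ‖((Lp.memLp f).indicator hA).toLp (A.indicator f)‖ ≤ 1 * ‖f‖ := by
  rw [one_mul]
  refine Lp.norm_le_norm_of_ae_le ?_
  filter_upwards [((Lp.memLp f).indicator hA).coeFn_toLp] with x hx
  rw [hx]
  exact norm_indicator_le_norm_self _ _

/-- The spectral projection `1_A(x̂)` of the position operator: multiplication by the indicator
function of `A`. -/
def positionProjection (A : Set ℝ) (hA : MeasurableSet A) : Mode →L[ℂ] Mode :=
  LinearMap.mkContinuous
    { toFun := fun f => ((Lp.memLp f).indicator hA).toLp (A.indicator f)
      map_add' := fun f g => by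
        rw [← MemLp.toLp_add]
        refine MemLp.toLp_congr _ _ ?_
        filter_upwards [Lp.coeFn_add f g] with x hx
        by_cases h : x ∈ A
        · simpa [h] using hx
        · simp [h]
      map_smul' := fun c f => by
        rw [RingHom.id_apply, ← MemLp.toLp_const_smul]
        refine MemLp.toLp_congr _ _ ?_
        filter_upwards [Lp.coeFn_smul c f] with x hx
        by_cases h : x ∈ A
        · simpa [h] using hx
        · simp [h] }
    1 (norm_toLp_indicator_le A hA)

/-- The spectral projection `1_A(q̂_θ) = ∫_A |q⟩⟨q|_{q̂_θ} dq` of the quadrature operator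
`q̂_θ = (cos θ) x̂ + (sin θ) p̂ = e^{i θ n̂} x̂ e^{-i θ n̂}`. -/
def quadratureProjection (θ : ℝ) (A : Set ℝ) (hA : MeasurableSet A) : Mode →L[ℂ] Mode :=
  ((phaseRotation θ).toContinuousLinearEquiv : Mode →L[ℂ] Mode) ∘L positionProjection A hA ∘L
    ((phaseRotation θ).symm.toContinuousLinearEquiv : Mode →L[ℂ] Mode)

/-- The window of size `η` around `x`. -/
def window (x η : ℝ) : Set ℝ := Set.Icc (x - η / 2) (x + η / 2)

theorem measurableSet_window (x η : ℝ) : MeasurableSet (window x η) := measurableSet_Icc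

/-- The witness operator: the quadrature projector onto the window of size `η` around `x`. -/
def witness (θ x η : ℝ) : Mode →L[ℂ] Mode :=
  quadratureProjection θ (window x η) (measurableSet_window x η)

/-! ### Trace and trace norm -/

/-- The trace `∑ₙ ⟨n|T|n⟩`. -/
def trace (T : Mode →L[ℂ] Mode) : ℂ := ∑' n, ⟪fockBasis n, T (fockBasis n)⟫_ℂ

/-- The absolute value `|T| = √(T* T)` of a bounded operator on a Hilbert space. -/
def operatorAbs {H : Type*} [NormedAddCommGroup H] [InnerProductSpace ℂ H] [CompleteSpace H]
    (T : H →L[ℂ] H) : H →L[ℂ] H := CFC.abs T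

/-- The trace norm `‖T‖₁ = Tr |T|`, with value `∞` if `T` is not of trace class. -/
def traceNorm (T : Mode →L[ℂ] Mode) : ℝ≥0∞ :=
  ∑' n, ENNReal.ofReal (⟪fockBasis n, operatorAbs T (fockBasis n)⟫_ℂ).re

/-! ### Energy and stellar rank -/

/-- The expectation value `⟨n̂⟩_ψ = ∑ₙ n |⟨n|ψ⟩|²` of the number operator (possibly `∞`). -/
def energy (ψ : Mode) : ℝ≥0∞ := ∑' n : ℕ, (n : ℝ≥0∞) * ‖⟪fockBasis n, ψ⟫_ℂ‖ₑ ^ 2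

/-- The density operator `|ψ⟩⟨ψ|`. -/
def pureState (ψ : Mode) : Mode →L[ℂ] Mode := InnerProductSpace.rankOne ℂ ψ ψ

/-- The coherent state `|α⟩ = e^{-|α|²/2} ∑ₙ αⁿ / √(n!) |n⟩`. -/
def coherent (α : ℂ) : Mode :=
  (Real.exp (-(‖α‖ ^ 2 / 2)) : ℂ) • ∑' n : ℕ, (α ^ n / (Real.sqrt n.factorial : ℂ)) • fockBasis n

/-- The stellar function `α ↦ e^{|α|²/2} ⟨α*|ψ⟩`. -/
def stellarFunction (ψ : Mode) (α : ℂ) : ℂ :=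
  (Real.exp (‖α‖ ^ 2 / 2) : ℂ) * ⟪coherent (starRingEnd ℂ α), ψ⟫_ℂ

/-- The stellar rank of a pure state: the number of zeros of its stellar function, counted with
multiplicity. -/
def stellarRank (ψ : Mode) : ℕ∞ :=
  ⨆ s : Finset ℂ, ∑ z ∈ s, analyticOrderAt (stellarFunction ψ) z

/-- `ρ = ∑ᵢ pᵢ |ψᵢ⟩⟨ψᵢ|` is a statistical decomposition of `ρ` into pure states. -/
structure IsDecomposition (ρ : Mode →L[ℂ] Mode) (p : ℕ → ℝ) (ψ : ℕ → Mode) : Prop where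
  nonneg : ∀ i, 0 ≤ p i
  hasSum_one : HasSum p 1
  norm_eq_one : ∀ i, ‖ψ i‖ = 1
  hasSum : HasSum (fun i => p i • pureState (ψ i)) ρ

/-- The stellar rank of a (possibly mixed) state: the infimum, over all statistical
decompositions, of the largest stellar rank of the components. -/
def mixedStellarRank (ρ : Mode →L[ℂ] Mode) : ℕ∞ :=
  sInf {r | ∃ p ψ, IsDecomposition ρ p ψ ∧ r = ⨆ i, stellarRank (ψ i)}

/-! ### Energy-bounded states and the threshold value -/

/-- The density operators of the pure states of energy at most `E`. -/
def energyBoundedPureStates (E : ℝ) : Set (Mode →L[ℂ] Mode) :=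
  {ρ | ∃ ψ : Mode, ‖ψ‖ = 1 ∧ energy ψ ≤ ENNReal.ofReal E ∧ ρ = pureState ψ}

/-- `𝒮^E`: the closed convex hull, with respect to the trace norm, of the pure states of energy at
most `E`. -/
def energyBoundedStates (E : ℝ) : Set (Mode →L[ℂ] Mode) :=
  {ρ | ∀ δ : ℝ≥0∞, 0 < δ → ∃ τ ∈ convexHull ℝ (energyBoundedPureStates E), traceNorm (ρ - τ) < δ}

/-- `𝒮_r^E`: the states in `𝒮^E` of stellar rank at most `r`. For `r = 0` these are the Gaussian
states with energy bounded by `E`. -/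
def boundedRankStates (r : ℕ) (E : ℝ) : Set (Mode →L[ℂ] Mode) :=
  {ρ | ρ ∈ energyBoundedStates E ∧ mixedStellarRank ρ ≤ r}

/-- The threshold value `w^E_{θ,x,η}`: the infimum of `Tr(σ W_{θ,x,η})` over `σ ∈ 𝒮_0^E`. -/
def threshold (E θ x η : ℝ) : ℝ :=
  sInf ((fun σ => (trace (σ ∘L witness θ x η)).re) '' boundedRankStates 0 E)

/-! ### The measurement record -/

/-- `q` is the outcome of a measurement of the quadrature `q̂_θ` on the state `σ` (Born rule). -/
structure IsQuadratureOutcome {Ω : Type*} [MeasurableSpace Ω] (P : Measure Ω) (θ : ℝ)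
    (σ : Mode →L[ℂ] Mode) (q : Ω → ℝ) : Prop where
  measurable : Measurable q
  born : ∀ (A : Set ℝ) (hA : MeasurableSet A),
    P.real (q ⁻¹' A) = (trace (σ ∘L quadratureProjection θ A hA)).re

/-- The fraction of the outcomes `q₁, …, q_M` that fall in the window of size `η` around `x`. -/
def windowFraction {M : ℕ} (x η : ℝ) (q : Fin M → ℝ) : ℝ :=
  (1 / (M : ℝ)) * ∑ j, (window x η).indicator (fun _ => (1 : ℝ)) (q j)

end Bosonic

end

/-!
Each indicator `χ(q_j)` of the window is a `[0, 1]`-valued random variable whose mean is, by the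
Born rule, `Tr(σ W)`. As `σ` itself takes part in the infimum defining the threshold `w`, this mean
is at least `w`, so the event `w̄ < w - ε` forces the sum of the `M` centred variables
`Tr(σ W) - χ(q_j)` to be at least `M ε`, and Hoeffding's inequality bounds the probability of that
by `exp (-2 M ε²)`.

The infimum is a lower bound because the values `Tr(τ W)` are bounded below. A state `τ` of finite
stellar rank has a decomposition `τ = ∑ᵢ pᵢ |ψᵢ⟩⟨ψᵢ|`, and `hasSum_trace_comp` computes
`Tr(τ A) = ∑ᵢ pᵢ ⟨ψᵢ, A ψᵢ⟩` by interchanging two absolutely convergent sums. For the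
projection `A = W` every term is nonnegative.
-/

open MeasureTheory ProbabilityTheory Bosonic
open scoped InnerProductSpace

namespace Bosonic

/-! ### The trace of a mixture against a bounded operator -/

theorem hasSum_norm_inner_sq (f : Mode) :
    HasSum (fun n => ‖⟪fockBasis n, f⟫_ℂ‖ ^ 2) (‖f‖ ^ 2) := by
  have h := Complex.hasSum_re (fockBasis.hasSum_inner_mul_inner f f)
  convert h using 1
  · ext n
    have e := inner_mul_symm_re_eq_norm (𝕜 := ℂ) f (fockBasis n)
    rw [RCLike.re_to_complex] at e
    rw [e, norm_mul, ← norm_inner_symm f, sq]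
  · exact (inner_self_eq_norm_sq (𝕜 := ℂ) f).symm

/-- The double series behind `Tr(ρ A)` converges absolutely: the `i`-th row is dominated by
`pᵢ (‖A†‖² + 1) / 2`. -/
theorem summable_trace_terms {p : ℕ → ℝ} {ψ : ℕ → Mode} (hp : ∀ i, 0 ≤ p i) (hs : Summable p)
    (hψ : ∀ i, ‖ψ i‖ = 1) (A : Mode →L[ℂ] Mode) :
    Summable (Function.uncurry fun i n : ℕ =>
      (p i : ℂ) * (⟪ψ i, A (fockBasis n)⟫_ℂ * ⟪fockBasis n, ψ i⟫_ℂ)) := by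
  have row (i : ℕ) : HasSum (fun n => p i * ((‖⟪fockBasis n, A.adjoint (ψ i)⟫_ℂ‖ ^ 2 +
      ‖⟪fockBasis n, ψ i⟫_ℂ‖ ^ 2) / 2)) (p i * ((‖A.adjoint (ψ i)‖ ^ 2 + ‖ψ i‖ ^ 2) / 2)) :=
    (((hasSum_norm_inner_sq _).add (hasSum_norm_inner_sq _)).div_const 2).mul_left _
  have hg : Summable fun x : ℕ × ℕ => p x.1 * ((‖⟪fockBasis x.2, A.adjoint (ψ x.1)⟫_ℂ‖ ^ 2 +
      ‖⟪fockBasis x.2, ψ x.1⟫_ℂ‖ ^ 2) / 2) := by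
    refine (summable_prod_of_nonneg fun x => mul_nonneg (hp _) (by positivity)).2
      ⟨fun i => (row i).summable, ?_⟩
    simp only [fun i => (row i).tsum_eq]
    refine (hs.mul_right ((‖A.adjoint‖ ^ 2 + 1) / 2)).of_nonneg_of_le
      (fun i => mul_nonneg (hp i) (by positivity)) fun i => ?_
    have hA : ‖A.adjoint (ψ i)‖ ≤ ‖A.adjoint‖ := by
      simpa [hψ i] using A.adjoint.le_opNorm (ψ i)
    have := hp i
    rw [hψ i, one_pow]
    gcongr
  refine hg.of_norm_bounded fun x => ?_
  have e : ‖⟪ψ x.1, A (fockBasis x.2)⟫_ℂ‖ = ‖⟪fockBasis x.2, A.adjoint (ψ x.1)⟫_ℂ‖ := by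
    rw [← ContinuousLinearMap.adjoint_inner_left, norm_inner_symm]
  simp only [Function.uncurry, norm_mul, Complex.norm_real, Real.norm_eq_abs, abs_of_nonneg (hp _),
    e]
  refine mul_le_mul_of_nonneg_left ?_ (hp _)
  have := two_mul_le_add_sq ‖⟪fockBasis x.2, A.adjoint (ψ x.1)⟫_ℂ‖ ‖⟪fockBasis x.2, ψ x.1⟫_ℂ‖
  linarith

theorem hasSum_trace_comp {ρ : Mode →L[ℂ] Mode} {p : ℕ → ℝ} {ψ : ℕ → Mode}
    (h : IsDecomposition ρ p ψ) (A : Mode →L[ℂ] Mode) :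
    HasSum (fun i => (p i : ℂ) * ⟪ψ i, A (ψ i)⟫_ℂ) (trace (ρ ∘L A)) := by
  have hs := summable_trace_terms h.nonneg h.hasSum_one.summable h.norm_eq_one A
  have col (n : ℕ) : ⟪fockBasis n, (ρ ∘L A) (fockBasis n)⟫_ℂ =
      ∑' i, (p i : ℂ) * (⟪ψ i, A (fockBasis n)⟫_ℂ * ⟪fockBasis n, ψ i⟫_ℂ) := by
    have h1 := (h.hasSum.mapL
      (ContinuousLinearMap.apply ℂ Mode (A (fockBasis n)))).mapL (innerSL ℂ (fockBasis n))
    refine Eq.trans ?_ (h1.congr_fun ?_).tsum_eq.symm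
    · simp
    · intro i
      simp [pureState, ← Complex.coe_smul]
  have row (i : ℕ) : ∑' n, (p i : ℂ) * (⟪ψ i, A (fockBasis n)⟫_ℂ * ⟪fockBasis n, ψ i⟫_ℂ) =
      (p i : ℂ) * ⟪ψ i, A (ψ i)⟫_ℂ := by
    rw [tsum_mul_left]
    simp only [← ContinuousLinearMap.adjoint_inner_left]
    rw [fockBasis.tsum_inner_mul_inner]
  have ht := hs.prod.hasSum
  simp only [Function.uncurry_apply_pair] at ht
  rw [← hs.tsum_comm] at ht
  simp only [row, ← col] at ht
  exact ht

/-! ### The threshold as a lower bound -/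

theorem re_inner_positionProjection_nonneg (A : Set ℝ) (hA : MeasurableSet A) (f : Mode) :
    0 ≤ (⟪f, positionProjection A hA f⟫_ℂ).re := by
  have hf : positionProjection A hA f =ᵐ[volume] A.indicator f :=
    ((Lp.memLp f).indicator hA).coeFn_toLp
  rw [L2.inner_def]
  change 0 ≤ RCLike.re (∫ x, ⟪f x, positionProjection A hA f x⟫_ℂ)
  rw [← integral_re (L2.integrable_inner f _)]
  refine integral_nonneg_of_ae ?_
  filter_upwards [hf] with x hx
  rw [hx]
  by_cases h : x ∈ A
  · rw [Set.indicator_of_mem h]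
    exact inner_self_nonneg
  · simp [h]

theorem re_inner_quadratureProjection_nonneg (θ : ℝ) (A : Set ℝ) (hA : MeasurableSet A)
    (f : Mode) : 0 ≤ (⟪f, quadratureProjection θ A hA f⟫_ℂ).re := by
  obtain ⟨g, rfl⟩ := (phaseRotation θ).surjective f
  have e : quadratureProjection θ A hA (phaseRotation θ g) =
      phaseRotation θ (positionProjection A hA g) := by
    simp [quadratureProjection]
  rw [e, LinearIsometryEquiv.inner_map_map]
  exact re_inner_positionProjection_nonneg A hA g

theorem exists_isDecomposition {r : ℕ} {E : ℝ} {ρ : Mode →L[ℂ] Mode}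
    (hρ : ρ ∈ boundedRankStates r E) : ∃ p ψ, IsDecomposition ρ p ψ := by
  by_contra! h
  -- Without a decomposition the stellar rank is `sInf ∅ = ⊤` in `ℕ∞`.
  have h1 : mixedStellarRank ρ = ⊤ := by simp [mixedStellarRank, h]
  have h2 := hρ.2
  rw [h1] at h2
  exact ENat.natCast_ne_top r (top_le_iff.1 h2)

theorem re_trace_witness_nonneg {r : ℕ} {E : ℝ} {ρ : Mode →L[ℂ] Mode}
    (hρ : ρ ∈ boundedRankStates r E) (θ x η : ℝ) : 0 ≤ (trace (ρ ∘L witness θ x η)).re := by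
  obtain ⟨p, ψ, h⟩ := exists_isDecomposition hρ
  refine (Complex.hasSum_re (hasSum_trace_comp h (witness θ x η))).nonneg fun i => ?_
  rw [Complex.re_ofReal_mul]
  exact mul_nonneg (h.nonneg i) (re_inner_quadratureProjection_nonneg _ _ _ _)

theorem threshold_le {E : ℝ} {σ : Mode →L[ℂ] Mode} (hσ : σ ∈ boundedRankStates 0 E)
    (θ x η : ℝ) : threshold E θ x η ≤ (trace (σ ∘L witness θ x η)).re := by
  refine csInf_le ⟨0, ?_⟩ (Set.mem_image_of_mem _ hσ)
  rintro _ ⟨τ, hτ, rfl⟩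
  exact re_trace_witness_nonneg hτ θ x η

/-! ### Concentration of the window fraction -/

theorem IsQuadratureOutcome.integral_window {Ω : Type*} [MeasurableSpace Ω] {P : Measure Ω}
    {θ : ℝ} {σ : Mode →L[ℂ] Mode} {q : Ω → ℝ} (hq : IsQuadratureOutcome P θ σ q) (x η : ℝ) :
    ∫ ω, (window x η).indicator (fun _ => (1 : ℝ)) (q ω) ∂P =
      (trace (σ ∘L witness θ x η)).re := by
  rw [witness, ← hq.born, ← integral_indicator_one (hq.measurable (measurableSet_window x η))]
  rfl

end Bosonic

open MeasureTheory ProbabilityTheory Bosonic in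
theorem theorem5 (θ x η E ε : ℝ) (hη : 0 < η) (hE : 0 ≤ E) (hε : 0 < ε) (M : ℕ)
    (σ : Mode →L[ℂ] Mode) (hσ : σ ∈ boundedRankStates 0 E)
    {Ω : Type*} [MeasurableSpace Ω] (P : Measure Ω) [IsProbabilityMeasure P]
    (q : Fin M → Ω → ℝ) (hq : ∀ j, IsQuadratureOutcome P θ σ (q j)) (hindep : iIndepFun q P) :
    P.real {ω | windowFraction x η (fun j => q j ω) < threshold E θ x η - ε} ≤
      Real.exp (-2 * M * ε ^ 2) := by
  rcases Nat.eq_zero_or_pos M with rfl | hM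
  · simp
  set χ : ℝ → ℝ := (window x η).indicator fun _ => (1 : ℝ) with hχ
  set w : ℝ := (trace (σ ∘L witness θ x η)).re with hw
  have hχm : Measurable χ := measurable_const.indicator (measurableSet_window x η)
  have hM' : (0 : ℝ) < M := by exact_mod_cast hM
  -- Hoeffding's inequality controls upper tails, so it is applied to the variables `w - χ(q_j)`.
  have hsub (j : Fin M) : HasSubgaussianMGF (fun ω => w - χ (q j ω)) ((‖(1 : ℝ) - 0‖₊ / 2) ^ 2)
      P := by
    have h := (hasSubgaussianMGF_of_mem_Icc (μ := P) (a := 0) (b := 1) (X := fun ω => χ (q j ω))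
      (hχm.comp (hq j).measurable).aemeasurable
      (.of_forall fun ω => by by_cases h : q j ω ∈ window x η <;> simp [hχ, h])).neg
    rw [(hq j).integral_window x η] at h
    refine h.congr (.of_forall fun ω => ?_)
    simp [hw]
  have hind : iIndepFun (fun j ω => w - χ (q j ω)) P :=
    hindep.comp (fun _ y => w - χ y) fun _ => measurable_const.sub hχm
  have hoeff := HasSubgaussianMGF.measure_sum_ge_le_of_iIndepFun hind (s := Finset.univ)
    (fun j _ => hsub j) (ε := M * ε) (by positivity)
  have hexp : -(M * ε) ^ 2 / (2 * ((∑ _j : Fin M, (‖(1 : ℝ) - 0‖₊ / 2) ^ 2 : NNReal) : ℝ)) =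
      -2 * M * ε ^ 2 := by
    simp
    field_simp
  push_cast at hexp hoeff
  rw [hexp] at hoeff
  refine le_trans (measureReal_mono fun ω hω => ?_) hoeff
  have h1 : 1 / (M : ℝ) * ∑ j, χ (q j ω) < threshold E θ x η - ε := hω
  have h2 := threshold_le hσ θ x η
  have h3 : ∑ j, χ (q j ω) < M * (w - ε) := by
    rw [one_div, inv_mul_lt_iff₀ hM'] at h1
    exact h1.trans_le (by gcongr)
  simp only [Set.mem_ofPred_eq, Finset.sum_sub_distrib, Finset.sum_const, Finset.card_univ,
    Fintype.card_fin, nsmul_eq_mul]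
  linarith
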